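/- Let $p>3$ be a prime. For rational numbers $x,y$ write $x\equiv y\pmod{p^3}$ if $x-y=p^3r$ for some rational number $r$ whose reduced denominator is not divisible by $p$. Let $q_p(a)=(a^{p-1}-1)/p$ be the Fermat quotient, $H_n=1+\frac12+\cdots+\frac1n$, and let $B_n$ be the Bernoulli numbers, given by $B_0=1$ and $\sum_{k=0}^{n-1}\binom nkB_k=0$ for $n\ge2$. Then $$\text{(i)}\quad \sum_{k=1}^{p-1}\frac{\binom{2k}k\binom{3k}k}{27^k\,k}\equiv 3q_p(3)-\frac32\,p\,q_p(3)^2+p^2q_p(3)^3+\frac{52}{27}\,p^2B_{p-3}\pmod{p^3},$$ $$\text{(ii)}\quad \sum_{k=1}^{p-1}\frac{\binom{2k}k\binom{4k}{2k}}{64^k\,k}\equiv 6q_p(2)-3p\,q_p(2)^2+2p^2q_p(2)^3+\frac72\,p^2B_{p-3}\pmod{p^3},$$ $$\text{(iii)}\quad \sum_{k=1}^{p-1}\frac{\binom{6k}{3k}\binom{3k}k}{432^k\,k}\equiv 4q_p(2)+3q_p(3)-p\Big(2q_p(2)^2+\frac32q_p(3)^2\Big)+p^2\Big(\frac43q_p(2)^3+q_p(3)^3\Big)+\frac{455}{54}\,p^2B_{p-3}\pmod{p^3}.$$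 Moreover, $$6q_p(2)-3p\,q_p(2)^2+2p^2q_p(2)^3+\frac72\,p^2B_{p-3}\equiv-3H_{\frac{p-1}2}+\frac74\,p^2B_{p-3}\pmod{p^3},$$ so (ii) is equivalent to Z.-W. Sun's conjectured congruence $$\sum_{k=1}^{p-1}\frac{\binom{2k}k\binom{4k}{2k}}{64^k\,k}\equiv-3H_{\frac{p-1}2}+\frac74\,p^2B_{p-3}\pmod{p^3},$$ which therefore holds as well. -/

import Mathlib

/-- `r` lies in the ring of rational `p`-integers (the rational numbers that are `p`-adic integers):
`p` does not divide the reduced denominator of `r`. -/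
def IsRatPIntegral (p : ℕ) (r : ℚ) : Prop := ¬ p ∣ r.den

/-- The congruence `x ≡ y (mod p ^ n)` between rational numbers, in the usual sense of the
ring of rational `p`-integers: `x - y = p ^ n * r` for some rational `p`-integer `r`. -/
def RatModEq (p n : ℕ) (x y : ℚ) : Prop :=
  ∃ r : ℚ, IsRatPIntegral p r ∧ x - y = (p : ℚ) ^ n * r

/-- The Fermat quotient `q_p(a) = (a ^ (p - 1) - 1) / p`, as a rational number. -/
def fermatQuotient (p : ℕ) (a : ℚ) : ℚ := (a ^ (p - 1) - 1) / p

/-! All three sums are S(a) = Σ C(a,k) C(-1-a,k)/k over 0 < k < p, at a = -1/d with d = 3, 4, 6. The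
difference S(a) - S(a-1) telescopes to (2/a)(P(a) - 1), where P(a) = Π (1 - a²/j²) over 0 < j < p
(`chooseSum_sub`). Write p = dm + r and go from -p/d to -r/d in m unit steps. At the start, a is
divisible by p and S(a) ≡ -a Σ 1/j² - a² Σ 1/j³ mod p³. Along the walk, a(a-p)P(a) is constant mod
p³ (`sineProd_mem`). Hence S(-r/d) reduces to Σ 1/x and Σ 1/x³ over 0 < x < p, x ≡ p mod d
(`chooseSum_mem`). Since p ≡ ±1 mod d, r is 1 or d-1, and the symmetry a ↔ -1-a reaches -1/d in both
cases.

The sums over residue classes satisfy linear relations: Lerch's formula (`truncLog_pow_sub_mem`),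
from the p-adic logarithm of d^(p-1) = Π (1 + pf/r); the reflection r ↦ p - r; and the comparison of
power sums over n and over dn, which brings in B_{p-3}. For d = 2, 3, 4, 6 these relations determine
the needed combinations. The polynomials in Fermat quotients are log(a^(p-1))/p, truncated
(`truncLog_pow_div`). -/

/-- The ring of rational `p`-integers. -/
def ratPInt (p : ℕ) [hp : Fact p.Prime] : Subring ℚ where
  carrier := {r | IsRatPIntegral p r}
  mul_mem' {x y} hx hy h := by
    rcases (hp.out.dvd_mul).1 (h.trans (Rat.mul_den_dvd x y)) with h | h
    exacts [hx h, hy h]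
  add_mem' {x y} hx hy h := by
    rcases (hp.out.dvd_mul).1 (h.trans (Rat.add_den_dvd x y)) with h | h
    exacts [hx h, hy h]
  one_mem' h := hp.out.one_lt.ne' (Nat.dvd_one.1 (by simpa using h))
  zero_mem' h := hp.out.one_lt.ne' (Nat.dvd_one.1 (by simpa using h))
  neg_mem' {x} hx h := hx (by simpa using h)

/-- The additive group of rational numbers divisible by `p ^ n` among the rational `p`-integers. -/
def pPow (p : ℕ) [Fact p.Prime] (n : ℕ) : AddSubgroup ℚ :=
  (ratPInt p).toAddSubgroup.map (AddMonoidHom.mulLeft ((p : ℚ) ^ n))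

theorem not_dvd_of_mem_Ico {p r : ℕ} (hr : r ∈ Finset.Ico 1 p) : ¬ p ∣ r := by
  rw [Finset.mem_Ico] at hr
  exact fun h => absurd (Nat.le_of_dvd (by omega) h) (by omega)

theorem not_dvd_two {p : ℕ} (h3 : 3 < p) : ¬ p ∣ 2 := fun h => by
  have := Nat.le_of_dvd (by norm_num) h; omega

theorem not_dvd_three {p : ℕ} (h3 : 3 < p) : ¬ p ∣ 3 := fun h => by
  have := Nat.le_of_dvd (by norm_num) h; omega

/-! ### Arithmetic modulo powers of p in the rational p-integers. -/

section PInt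

variable {p : ℕ} [hp : Fact p.Prime]

theorem mem_pPow {n : ℕ} {x : ℚ} : x ∈ pPow p n ↔ ∃ r ∈ ratPInt p, x = (p : ℚ) ^ n * r := by
  constructor
  · rintro ⟨r, hr, rfl⟩
    exact ⟨r, hr, rfl⟩
  · rintro ⟨r, hr, rfl⟩
    exact ⟨r, hr, rfl⟩

theorem ratModEq_iff {n : ℕ} {x y : ℚ} : RatModEq p n x y ↔ x - y ∈ pPow p n := mem_pPow.symm

theorem pPow_mul_mem {n : ℕ} {r : ℚ} (hr : r ∈ ratPInt p) : (p : ℚ) ^ n * r ∈ pPow p n :=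
  mem_pPow.2 ⟨r, hr, rfl⟩

theorem mul_mem_pPow {m n : ℕ} {x y : ℚ} (hx : x ∈ pPow p m) (hy : y ∈ pPow p n) :
    x * y ∈ pPow p (m + n) := by
  obtain ⟨r, hr, rfl⟩ := mem_pPow.1 hx
  obtain ⟨s, hs, rfl⟩ := mem_pPow.1 hy
  exact mem_pPow.2 ⟨r * s, mul_mem hr hs, by ring⟩

theorem smul_mem_pPow {n : ℕ} {x y : ℚ} (hx : x ∈ ratPInt p) (hy : y ∈ pPow p n) :
    x * y ∈ pPow p n := by
  obtain ⟨s, hs, rfl⟩ := mem_pPow.1 hy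
  exact mem_pPow.2 ⟨x * s, mul_mem hx hs, by ring⟩

theorem ratPInt_of_mem_pPow {n : ℕ} {x : ℚ} (hx : x ∈ pPow p n) : x ∈ ratPInt p := by
  obtain ⟨s, hs, rfl⟩ := mem_pPow.1 hx
  exact mul_mem (pow_mem (natCast_mem _ p) n) hs

theorem mem_pPow_of_le {m n : ℕ} (h : m ≤ n) {x : ℚ} (hx : x ∈ pPow p n) : x ∈ pPow p m := by
  obtain ⟨k, rfl⟩ := Nat.exists_eq_add_of_le h
  obtain ⟨s, hs, rfl⟩ := mem_pPow.1 hx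
  exact mem_pPow.2 ⟨p ^ k * s, mul_mem (pow_mem (natCast_mem _ p) k) hs, by ring⟩

theorem p_mul_mem_pPow {n : ℕ} (m : ℕ) {x : ℚ} (hx : x ∈ pPow p n) :
    (p : ℚ) ^ m * x ∈ pPow p (m + n) := by
  obtain ⟨s, hs, rfl⟩ := mem_pPow.1 hx
  exact mem_pPow.2 ⟨s, hs, by ring⟩

theorem mem_pPow_of_p_mul {n m : ℕ} {x : ℚ} (hx : (p : ℚ) ^ m * x ∈ pPow p (m + n)) :
    x ∈ pPow p n := by
  have h0 : (p : ℚ) ^ m ≠ 0 := pow_ne_zero _ (Nat.cast_ne_zero.2 hp.out.ne_zero)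
  obtain ⟨s, hs, h⟩ := mem_pPow.1 hx
  refine mem_pPow.2 ⟨s, hs, mul_left_cancel₀ h0 ?_⟩
  rw [h]; ring

theorem inv_natCast_mem {n : ℕ} (h : ¬ p ∣ n) : (n : ℚ)⁻¹ ∈ ratPInt p := fun hd =>
  h (hd.trans (by
    rw [Rat.inv_natCast_den]
    split_ifs
    · exact one_dvd _
    · exact dvd_rfl))

theorem natCast_mem_pPow_one {n : ℕ} (h : p ∣ n) : (n : ℚ) ∈ pPow p 1 := by
  obtain ⟨m, rfl⟩ := h
  exact mem_pPow.2 ⟨m, natCast_mem _ m, by push_cast; ring⟩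

theorem natCast_pow_sub_one_mem {n : ℕ} (h : ¬ p ∣ n) : (n : ℚ) ^ (p - 1) - 1 ∈ pPow p 1 := by
  have h1 : IsCoprime (n : ℤ) p :=
    Nat.isCoprime_iff_coprime.2 ((Nat.Prime.coprime_iff_not_dvd hp.out).2 h).symm
  obtain ⟨k, hk⟩ := (Int.modEq_iff_dvd.1 (Int.ModEq.pow_card_sub_one_eq_one hp.out h1).symm)
  refine mem_pPow.2 ⟨k, intCast_mem _ k, ?_⟩
  have := congrArg (Int.cast : ℤ → ℚ) hk
  push_cast at this
  rw [this, pow_one]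

theorem half_mem (h3 : 3 < p) : (1 / 2 : ℚ) ∈ ratPInt p := by
  simpa using inv_natCast_mem (not_dvd_two h3)

theorem third_mem (h3 : 3 < p) : (1 / 3 : ℚ) ∈ ratPInt p := by
  simpa using inv_natCast_mem (not_dvd_three h3)

/-- Rational numbers whose denominator divides a power of `6` are `p`-integers for `p > 3`. -/
theorem mem_of_den_six (h3 : 3 < p) {c : ℚ} (z : ℤ) (n : ℕ) (h : c * 6 ^ n = z) :
    c ∈ ratPInt p := by
  have : c = z * (1 / 2 * (1 / 3)) ^ n := by
    rw [← h, mul_assoc, ← mul_pow]; norm_num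
  rw [this]
  exact mul_mem (intCast_mem _ z) (pow_mem (mul_mem (half_mem h3) (third_mem h3)) n)

/-! ### The truncated logarithm -/

/-- The logarithm truncated after the third order term. -/
def truncLog (z : ℚ) : ℚ := (z - 1) - (z - 1) ^ 2 / 2 + (z - 1) ^ 3 / 3

/-- The formal identity log(zw) = log z + log w cancels all terms of total degree at most 3 in z-1
and w-1. Every remaining monomial carries p⁴, with only 2 and 3 in denominators. -/
theorem truncLog_mul (h3 : 3 < p) {z w : ℚ} (hz : z - 1 ∈ pPow p 1) (hw : w - 1 ∈ pPow p 1) :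
    truncLog (z * w) - (truncLog z + truncLog w) ∈ pPow p 4 := by
  obtain ⟨u, hu, hu'⟩ := mem_pPow.1 hz
  obtain ⟨v, hv, hv'⟩ := mem_pPow.1 hw
  obtain rfl : z = 1 + p * u := by linarith
  obtain rfl : w = 1 + p * v := by linarith
  have hP : (p : ℚ) ∈ ratPInt p := natCast_mem _ p
  have h2 := half_mem h3
  have h3' := third_mem h3
  have key : truncLog ((1 + p * u) * (1 + p * v)) -
      (truncLog (1 + p * u) + truncLog (1 + p * v)) =
      (p : ℚ) ^ 4 * (u * v * (u * u + v * v) + (3 * (1 / 2)) * u * u * v * v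
        + p * (u * u * v * v * (u + v)) + p * p * (1 / 3 * (u * u * u * v * v * v))) := by
    unfold truncLog; ring
  rw [key]
  have h3n : (3 : ℚ) ∈ ratPInt p := ofNat_mem _ 3
  apply pPow_mul_mem
  repeat first | assumption | apply mul_mem | apply add_mem

theorem mul_sub_one_mem {z w : ℚ} (hz : z - 1 ∈ pPow p 1) (hw : w - 1 ∈ pPow p 1) :
    z * w - 1 ∈ pPow p 1 := by
  have : z * w - 1 = (z - 1) + (w - 1) + (z - 1) * (w - 1) := by ring
  rw [this]
  exact add_mem (add_mem hz hw) (smul_mem_pPow (ratPInt_of_mem_pPow hz) hw)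

theorem truncLog_prod (h3 : 3 < p) {ι : Type*} (s : Finset ι) (z : ι → ℚ)
    (hz : ∀ i ∈ s, z i - 1 ∈ pPow p 1) :
    (∏ i ∈ s, z i) - 1 ∈ pPow p 1 ∧
      truncLog (∏ i ∈ s, z i) - ∑ i ∈ s, truncLog (z i) ∈ pPow p 4 := by
  classical
  induction s using Finset.induction_on with
  | empty => simp [truncLog]
  | insert a s ha ih =>
    obtain ⟨ih1, ih2⟩ := ih fun i hi => hz i (Finset.mem_insert_of_mem hi)
    have ha' := hz a (Finset.mem_insert_self a s)
    rw [Finset.prod_insert ha, Finset.sum_insert ha]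
    refine ⟨mul_sub_one_mem ha' ih1, ?_⟩
    have := add_mem (truncLog_mul h3 ha' ih1) ih2
    convert this using 1
    ring

end PInt

/-! ### The sums `∑ (a choose k) (-1-a choose k) / k` -/

/-- The product `(a choose k) * (-1-a choose k)`. -/
def chooseProd (a : ℚ) (k : ℕ) : ℚ := ∏ j ∈ Finset.range k, (a - j) * (-1 - a - j) / (j + 1) ^ 2

/-- The product of `1 - a ^ 2 / j ^ 2` over `1 ≤ j ≤ n`. -/
def sineProd (a : ℚ) (n : ℕ) : ℚ := ∏ j ∈ Finset.range n, (1 - a ^ 2 / (j + 1) ^ 2)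

/-- The sum of `(a choose k) * (-1-a choose k) / k` over `1 ≤ k ≤ n`. -/
def chooseSum (a : ℚ) (n : ℕ) : ℚ := ∑ k ∈ Finset.range n, chooseProd a (k + 1) / (k + 1)

theorem chooseProd_succ (a : ℚ) (k : ℕ) :
    chooseProd a (k + 1) = chooseProd a k * ((a - k) * (-1 - a - k) / (k + 1) ^ 2) :=
  Finset.prod_range_succ _ _

theorem sineProd_succ (a : ℚ) (n : ℕ) :
    sineProd a (n + 1) = sineProd a n * (1 - a ^ 2 / (n + 1) ^ 2) :=
  Finset.prod_range_succ _ _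

theorem chooseSum_succ (a : ℚ) (n : ℕ) :
    chooseSum a (n + 1) = chooseSum a n + chooseProd a (n + 1) / (n + 1) :=
  Finset.sum_range_succ _ _

theorem chooseProd_symm (a : ℚ) (k : ℕ) : chooseProd (-1 - a) k = chooseProd a k :=
  Finset.prod_congr rfl fun j _ => by ring

theorem chooseSum_symm (a : ℚ) (n : ℕ) : chooseSum (-1 - a) n = chooseSum a n := by
  simp only [chooseSum, chooseProd_symm]

/-- Rewriting the binomials as (3k)!/k!³ makes the ratio of successive terms visible; the next two
lemmas work the same way. -/
theorem chooseProd_third (k : ℕ) :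
    chooseProd (-1 / 3) k = ((2 * k).choose k * (3 * k).choose k : ℚ) / 27 ^ k := by
  have h (k : ℕ) : ((2 * k).choose k * (3 * k).choose k : ℚ) = (3 * k).factorial / k.factorial ^ 3 := by
    rw [Nat.cast_choose ℚ (show k ≤ 2 * k by omega), Nat.cast_choose ℚ (show k ≤ 3 * k by omega),
      show 2 * k - k = k by omega, show 3 * k - k = 2 * k by omega]
    have := Nat.factorial_ne_zero k
    have := Nat.factorial_ne_zero (2 * k)
    field_simp
  rw [h]
  induction k with
  | zero => simp [chooseProd]
  | succ k ih =>
    rw [chooseProd_succ, ih,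
      show 3 * (k + 1) = 3 * k + 1 + 1 + 1 by ring]
    simp only [Nat.factorial_succ]
    have := Nat.factorial_ne_zero k
    push_cast
    field_simp
    ring

theorem chooseProd_fourth (k : ℕ) :
    chooseProd (-1 / 4) k = ((2 * k).choose k * (4 * k).choose (2 * k) : ℚ) / 64 ^ k := by
  have h (k : ℕ) : ((2 * k).choose k * (4 * k).choose (2 * k) : ℚ) =
      (4 * k).factorial / (k.factorial ^ 2 * (2 * k).factorial) := by
    rw [Nat.cast_choose ℚ (show k ≤ 2 * k by omega),
      Nat.cast_choose ℚ (show 2 * k ≤ 4 * k by omega),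
      show 2 * k - k = k by omega, show 4 * k - 2 * k = 2 * k by omega]
    have := Nat.factorial_ne_zero k
    have := Nat.factorial_ne_zero (2 * k)
    field_simp
  rw [h]
  induction k with
  | zero => simp [chooseProd]
  | succ k ih =>
    rw [chooseProd_succ, ih,
      show 4 * (k + 1) = 4 * k + 1 + 1 + 1 + 1 by ring, show 2 * (k + 1) = 2 * k + 1 + 1 by ring]
    simp only [Nat.factorial_succ]
    have := Nat.factorial_ne_zero k
    have := Nat.factorial_ne_zero (2 * k)
    push_cast
    field_simp
    ring

theorem chooseProd_sixth (k : ℕ) :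
    chooseProd (-1 / 6) k = ((6 * k).choose (3 * k) * (3 * k).choose k : ℚ) / 432 ^ k := by
  have h (k : ℕ) : ((6 * k).choose (3 * k) * (3 * k).choose k : ℚ) =
      (6 * k).factorial / (k.factorial * (2 * k).factorial * (3 * k).factorial) := by
    rw [Nat.cast_choose ℚ (show k ≤ 3 * k by omega),
      Nat.cast_choose ℚ (show 3 * k ≤ 6 * k by omega),
      show 3 * k - k = 2 * k by omega, show 6 * k - 3 * k = 3 * k by omega]
    have := Nat.factorial_ne_zero k
    have := Nat.factorial_ne_zero (2 * k)
    have := Nat.factorial_ne_zero (3 * k)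
    field_simp
  rw [h]
  induction k with
  | zero => simp [chooseProd]
  | succ k ih =>
    rw [chooseProd_succ, ih,
      show 6 * (k + 1) = 6 * k + 1 + 1 + 1 + 1 + 1 + 1 by ring,
      show 3 * (k + 1) = 3 * k + 1 + 1 + 1 by ring, show 2 * (k + 1) = 2 * k + 1 + 1 by ring]
    simp only [Nat.factorial_succ]
    have := Nat.factorial_ne_zero k
    have := Nat.factorial_ne_zero (2 * k)
    have := Nat.factorial_ne_zero (3 * k)
    push_cast
    field_simp
    ring

theorem sum_Icc_eq_chooseSum {a : ℚ} {n : ℕ} {g : ℕ → ℚ} {c : ℚ}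
    (h : ∀ k, chooseProd a k = g k / c ^ k) :
    ∑ k ∈ Finset.Icc 1 n, g k / (c ^ k * k) = chooseSum a n := by
  rw [chooseSum, ← Finset.Ico_add_one_right_eq_Icc, Finset.sum_Ico_eq_sum_range]
  refine Finset.sum_congr rfl fun k _ => ?_
  rw [h, div_div, add_comm 1 k]
  push_cast
  rfl

theorem sineProd_neg (a : ℚ) (n : ℕ) : sineProd (-a) n = sineProd a n := by
  simp only [sineProd, neg_sq]

/-- Pair a-j with -(a+j), which comes from the preceding index, to get j² - a². The end factors a
and -(a+k+1) are left over. -/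
theorem chooseProd_succ_eq_sineProd (a : ℚ) (k : ℕ) :
    chooseProd a (k + 1) = -(a * (a + (k + 1))) / (k + 1) ^ 2 * sineProd a k := by
  induction k with
  | zero => simp [chooseProd, sineProd]; ring
  | succ k ih =>
    rw [chooseProd_succ, ih, sineProd_succ]
    push_cast
    field_simp
    ring

/-- By symmetry the value at a-1 is the value at -a. Both new terms are then multiples of the same
`sineProd a n`, and their difference is 2/a times the increment of `sineProd`. -/
theorem chooseSum_sub (a : ℚ) (ha : a ≠ 0) (n : ℕ) :
    chooseSum a n - chooseSum (a - 1) n = 2 / a * (sineProd a n - 1) := by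
  induction n with
  | zero => simp [chooseSum, sineProd]
  | succ n ih =>
    rw [chooseSum_succ, chooseSum_succ, sineProd_succ, chooseProd_succ_eq_sineProd,
      ← chooseProd_symm (a - 1), show -1 - (a - 1) = -a by ring, chooseProd_succ_eq_sineProd,
      sineProd_neg]
    have h0 : (n : ℚ) + 1 ≠ 0 := by positivity
    have h1 : (-(a * (a + (n + 1))) / (n + 1) ^ 2 * sineProd a n) / (n + 1)
        - (-(-a * (-a + (n + 1))) / (n + 1) ^ 2 * sineProd a n) / (n + 1)
        = 2 / a * (sineProd a n * (1 - a ^ 2 / (n + 1) ^ 2) - sineProd a n) := by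
      field_simp; ring
    linear_combination ih + h1

theorem chooseSum_add (s : ℚ) (m n : ℕ) (hs : ∀ i ∈ Finset.range m, s + (i + 1) ≠ 0) :
    chooseSum (s + m) n = chooseSum s n +
      ∑ i ∈ Finset.range m, 2 / (s + (i + 1)) * (sineProd (s + (i + 1)) n - 1) := by
  induction m with
  | zero => simp
  | succ m ih =>
    rw [Finset.sum_range_succ, ← add_assoc,
      ← ih fun i hi => hs i (Finset.mem_range.2 ((Finset.mem_range.1 hi).trans m.lt_succ_self)),
      ← chooseSum_sub _ (hs m (Finset.self_mem_range_succ m))]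
    rw [show s + ((m : ℚ) + 1) - 1 = s + m by ring]
    push_cast
    ring

/-- The shift moves the linear factors j-a and j+a by one index, so only end factors change.
Denominators are cleared so that the identity holds for every a. -/
theorem sineProd_add_one (a : ℚ) (n : ℕ) :
    (a + 1) * (a - n) * sineProd (a + 1) n = a * (a + (n + 1)) * sineProd a n := by
  induction n with
  | zero => simp [sineProd]; ring
  | succ n ih =>
    rw [sineProd_succ, sineProd_succ]
    have h0 : (n : ℚ) + 1 ≠ 0 := by positivity
    push_cast
    have h1 : (a + 1) * (a - (n + 1)) * (sineProd (a + 1) n * (1 - (a + 1) ^ 2 / (n + 1) ^ 2))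
       + (a - (n + 1)) * (a + (n + 2)) / (n + 1) ^ 2 * ((a + 1) * (a - n) * sineProd (a + 1) n)
       = a * (a + (n + 2)) * (sineProd a n * (1 - a ^ 2 / (n + 1) ^ 2)) +
         (a - (n + 1)) * (a + (n + 2)) / (n + 1) ^ 2 * (a * (a + (n + 1)) * sineProd a n) := by
      field_simp; ring
    linear_combination (-(a - (n + 1)) * (a + (n + 2)) / (n + 1) ^ 2) * ih + h1

/-! ### The sine product near multiples of p. -/

section

variable {p : ℕ} [hp : Fact p.Prime]

theorem inv_succ_mem {j : ℕ} (hj : j ∈ Finset.range (p - 1)) : ((j : ℚ) + 1)⁻¹ ∈ ratPInt p := by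
  have hj := Finset.mem_range.1 hj
  exact_mod_cast inv_natCast_mem (p := p) (n := j + 1)
    (not_dvd_of_mem_Ico (Finset.mem_Ico.2 ⟨by omega, by omega⟩))

theorem sineProd_sub_one_mem {a : ℚ} {n : ℕ} (hn : n ≤ p - 1) (ha : a ∈ pPow p 1) :
    sineProd a n - 1 ∈ pPow p 2 := by
  induction n with
  | zero => simp [sineProd]
  | succ n ih =>
    rw [sineProd_succ]
    have ih := ih (by omega)
    have h1 : sineProd a n ∈ ratPInt p := by
      simpa using add_mem (ratPInt_of_mem_pPow ih) (one_mem (ratPInt p))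
    have h2 : (((n : ℚ) + 1)⁻¹) ^ 2 * sineProd a n * (a * a) ∈ pPow p 2 :=
      smul_mem_pPow (mul_mem (pow_mem (inv_succ_mem (Finset.mem_range.2 hn)) 2) h1)
        (mul_mem_pPow ha ha)
    convert sub_mem ih h2 using 1
    field_simp
    ring

theorem neg_div_sub_inv_mem {d r : ℕ} (hd : ¬ p ∣ d) (hr : ¬ p ∣ r) :
    -(r / d : ℚ) - p ≠ 0 ∧ (-(r / d : ℚ) - p)⁻¹ ∈ ratPInt p := by
  have hd0 : (d : ℚ) ≠ 0 := by rintro h; apply hd; simp [Nat.cast_eq_zero.1 h]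
  have hN : ¬ p ∣ r + d * p := by rwa [Nat.dvd_add_left (dvd_mul_left p d)]
  have hN0 : ((r + d * p : ℕ) : ℚ) ≠ 0 := Nat.cast_ne_zero.2 (by rintro h; simp [h] at hN)
  have h : -(r / d : ℚ) - p = -(((r + d * p : ℕ) : ℚ) / d) := by push_cast; field_simp; ring
  rw [h]
  refine ⟨neg_ne_zero.2 (div_ne_zero hN0 hd0), ?_⟩
  rw [← neg_inv, inv_div, div_eq_mul_inv]
  exact neg_mem (mul_mem (natCast_mem _ d) (inv_natCast_mem hN))

/-- The value of `sineProd` at `- p / d + i` modulo `p ^ 3`. -/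
theorem sineProd_mem {d m : ℕ} (hd : ¬ p ∣ d) (i : ℕ) (hi : i < m) (hm : d * m < p) :
    let a : ℚ := -(p / d) + (i + 1)
    a * (a - p) * sineProd a (p - 1) + (p : ℚ) ^ 2 * ((d - 1) / d ^ 2) ∈ pPow p 3 := by
  have hP : ((p - 1 : ℕ) : ℚ) = p - 1 := by
    rw [Nat.cast_sub hp.out.one_le]; simp
  have hd0 : (d : ℚ) ≠ 0 := by rintro h; apply hd; simp [Nat.cast_eq_zero.1 h]
  have hdi := inv_natCast_mem hd
  have hpm : (p : ℚ) ∈ pPow p 1 := natCast_mem_pPow_one dvd_rfl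
  have hC : ((d : ℚ) - 1) / d ^ 2 ∈ ratPInt p := by
    rw [div_eq_mul_inv, ← inv_pow]
    exact mul_mem (sub_mem (natCast_mem _ d) (one_mem _)) (pow_mem hdi 2)
  intro a
  induction i with
  -- With s = -p/d, the shift gives (s+1)(s+1-p)P(s+1) = s(s+p)P(s). Here s(s+p) = -p²(d-1)/d² and
  -- P(s) ≡ 1 mod p².
  | zero =>
    have h := sineProd_add_one (-(p / d : ℚ)) (p - 1)
    have h1 : sineProd (-(p / d : ℚ)) (p - 1) - 1 ∈ pPow p 2 := by
      refine sineProd_sub_one_mem le_rfl (neg_mem ?_)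
      rw [div_eq_mul_inv, mul_comm]
      exact smul_mem_pPow hdi hpm
    rw [hP] at h
    have : a = -(p / d : ℚ) + 1 := by simp [a]
    rw [this]
    have h3 : -(p : ℚ) ^ 2 * (((d - 1) / d ^ 2)) * (sineProd (-(p / d : ℚ)) (p - 1) - 1) ∈ pPow p 4 := by
      rw [neg_mul, neg_mul, mul_assoc]
      exact neg_mem (p_mul_mem_pPow 2 (smul_mem_pPow hC h1))
    convert mem_pPow_of_le (show 3 ≤ 4 by norm_num) h3 using 1
    rw [show (-(p / d : ℚ) + 1 - p) = -(p / d : ℚ) - (p - 1) by ring, mul_comm (-(p / d : ℚ) + 1),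
      mul_comm (-(p / d : ℚ) - (p - 1)), h]
    field_simp
    ring
  | succ i ih =>
    have ih := ih (by omega)
    simp only at ih
    set b : ℚ := -(p / d) + (i + 1) with hb
    have hab : a = b + 1 := by simp only [a, hb]; push_cast; ring
    have h := sineProd_add_one b (p - 1)
    rw [hP] at h
    have hlt : d * (i + 1) < p := lt_of_le_of_lt (Nat.mul_le_mul_left d hi.le) hm
    have hN : ¬ p ∣ p - d * (i + 1) := by
      rw [Nat.dvd_sub_iff_right hlt.le dvd_rfl]
      have : 0 < d * (i + 1) := by
        have : d ≠ 0 := by rintro rfl; simp at hd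
        positivity
      exact fun h => absurd (Nat.le_of_dvd this h) (by omega)
    obtain ⟨hbp0, hinv⟩ := neg_div_sub_inv_mem hd hN
    rw [show -(((p - d * (i + 1) : ℕ) : ℚ) / d) = b by
      rw [hb, Nat.cast_sub hlt.le]; push_cast; field_simp; ring] at hbp0 hinv
    -- With g(b) = b(b-p)P(b), the shift reads g(b+1) = g(b) + 2p·g(b)/(b-p). As b-p is a p-adic
    -- unit and p² divides g(b), the value is unchanged mod p³.
    have hg : b * (b - p) * sineProd b (p - 1) ∈ pPow p 2 := by
      have h3 := mem_pPow_of_le (show 2 ≤ 3 by norm_num) ih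
      simpa using sub_mem h3 (pPow_mul_mem (n := 2) hC)
    have h5 : 2 * (b - p)⁻¹ * (p * (b * (b - p) * sineProd b (p - 1))) ∈ pPow p 3 :=
      smul_mem_pPow (mul_mem (ofNat_mem _ 2) hinv) (mul_mem_pPow hpm hg)
    convert add_mem ih h5 using 1
    rw [hab, show b + 1 - p = b - (p - 1) by ring, h]
    field_simp
    ring

end

/-! ### Harmonic sums over residue classes -/

/-- The `r` with `0 < r < p` and `r ≡ - f p` modulo `d`. -/
def residueClass (p d f : ℕ) : Finset ℕ := (Finset.Ico 1 p).filter fun r => d ∣ r + f * p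

/-- The sum of `1 / r ^ k` over `0 < r < p` with `r ≡ - f p` modulo `d`. -/
def classSum (p d k f : ℕ) : ℚ := ∑ r ∈ residueClass p d f, 1 / (r : ℚ) ^ k

theorem mem_residueClass {p d f r : ℕ} :
    r ∈ residueClass p d f ↔ (1 ≤ r ∧ r < p) ∧ d ∣ r + f * p := by
  simp [residueClass]

/-- Division with remainder, dx = r + fp, is a bijection onto the pairs (f, r) with d ∣ r + fp. -/
theorem prod_Ico_mul_eq {M : Type*} [CommMonoid M] {p d : ℕ} (hd : 0 < d) (hpd : p.Coprime d)
    (F : ℕ → M) :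
    ∏ x ∈ Finset.Ico 1 p, F (d * x) =
      ∏ f ∈ Finset.range d, ∏ r ∈ residueClass p d f, F (r + f * p) := by
  rw [Finset.prod_sigma']
  refine Finset.prod_bij' (fun x _ => ⟨d * x / p, d * x % p⟩) (fun y _ => (y.2 + y.1 * p) / d)
    ?_ ?_ ?_ ?_ ?_
  · intro x hx
    rw [Finset.mem_Ico] at hx
    have hp : 0 < p := by omega
    have h1 := Nat.mod_add_div' (d * x) p
    have h2 := Nat.mod_lt (d * x) hp
    refine Finset.mem_sigma.2 ⟨Finset.mem_range.2 ?_, mem_residueClass.2 ⟨⟨?_, h2⟩, ?_⟩⟩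
    · rw [Nat.div_lt_iff_lt_mul hp]
      exact Nat.mul_lt_mul_of_pos_left hx.2 hd
    · rw [Nat.one_le_iff_ne_zero]
      intro h0
      have := hpd.dvd_of_dvd_mul_left (Nat.dvd_of_mod_eq_zero h0)
      exact absurd (Nat.le_of_dvd (by omega) this) (by omega)
    · simp only [h1]
      exact dvd_mul_right d x
  · rintro ⟨f, r⟩ hy
    obtain ⟨hf, hr⟩ := Finset.mem_sigma.1 hy
    obtain ⟨⟨hr1, hr2⟩, c, hc⟩ := mem_residueClass.1 hr
    have hf := Finset.mem_range.1 hf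
    simp only at hc hr1 hr2 hf ⊢
    rw [hc, Nat.mul_div_cancel_left _ hd, Finset.mem_Ico]
    constructor
    · rw [Nat.one_le_iff_ne_zero]; rintro rfl; omega
    · have : d * c < d * p := by
        rw [← hc]
        nlinarith [Nat.mul_le_mul_right p (show f + 1 ≤ d from hf)]
      exact lt_of_mul_lt_mul_left this hd.le
  · intro x hx
    simp only [Nat.mod_add_div', Nat.mul_div_cancel_left _ hd]
  · rintro ⟨f, r⟩ hy
    obtain ⟨hf, hr⟩ := Finset.mem_sigma.1 hy
    obtain ⟨⟨hr1, hr2⟩, hc⟩ := mem_residueClass.1 hr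
    simp only at hc hr1 hr2 hf ⊢
    rw [Nat.mul_div_cancel' hc, Nat.add_mul_div_right _ _ (by omega), Nat.div_eq_of_lt hr2,
      Nat.add_mul_mod_self_right, Nat.mod_eq_of_lt hr2, zero_add]
  · intro x hx
    simp only [Nat.mod_add_div']

theorem sum_Ico_mul_eq {M : Type*} [AddCommMonoid M] {p d : ℕ} (hd : 0 < d) (hpd : p.Coprime d)
    (F : ℕ → M) :
    ∑ x ∈ Finset.Ico 1 p, F (d * x) =
      ∑ f ∈ Finset.range d, ∑ r ∈ residueClass p d f, F (r + f * p) :=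
  prod_Ico_mul_eq (M := Multiplicative M) hd hpd F

/-- As p is invertible mod d, each r lies in the class of exactly one f < d. It is f = y/p for the
Chinese remainder y < pd with y ≡ r mod p and d ∣ y. -/
theorem prod_Ico_eq_prod_residueClass {M : Type*} [CommMonoid M] {p d : ℕ} (hd : 0 < d)
    (hpd : p.Coprime d) (F : ℕ → M) :
    ∏ x ∈ Finset.Ico 1 p, F x = ∏ f ∈ Finset.range d, ∏ r ∈ residueClass p d f, F r := by
  simp only [residueClass, Finset.prod_filter]
  rw [Finset.prod_comm]
  refine Finset.prod_congr rfl fun r hr => ?_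
  rw [Finset.mem_Ico] at hr
  let y := Nat.chineseRemainder hpd r 0
  have h1 : (y : ℕ) % p = r := by
    have := y.2.1
    rw [Nat.ModEq, Nat.mod_eq_of_lt hr.2] at this
    exact this
  have h2 : d ∣ y := (Nat.modEq_zero_iff_dvd).1 y.2.2
  have h3 : (y : ℕ) < p * d := Nat.chineseRemainder_lt_mul hpd r 0 (by omega) (by omega)
  have h4 := Nat.mod_add_div' (y : ℕ) p
  rw [h1] at h4
  have h5 : (y : ℕ) / p < d := by
    rw [Nat.div_lt_iff_lt_mul (by omega), mul_comm]; exact h3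
  rw [Finset.prod_eq_single ((y : ℕ) / p)]
  · rw [h4, if_pos h2]
  · intro f hf hne
    rw [if_neg]
    intro hdvd
    apply hne
    have hf := Finset.mem_range.1 hf
    have h6 : f * p ≡ (y : ℕ) / p * p [MOD d] := by
      apply Nat.ModEq.add_left_cancel' r
      rw [h4]
      exact ((Nat.modEq_zero_iff_dvd).2 hdvd).trans ((Nat.modEq_zero_iff_dvd).2 h2).symm
    have h7 := Nat.ModEq.cancel_right_of_coprime (by rw [Nat.gcd_comm]; exact hpd) h6
    rwa [Nat.ModEq, Nat.mod_eq_of_lt hf, Nat.mod_eq_of_lt h5] at h7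
  · intro h
    exact absurd (Finset.mem_range.2 h5) h

theorem sum_Ico_eq_sum_residueClass {M : Type*} [AddCommMonoid M] {p d : ℕ} (hd : 0 < d)
    (hpd : p.Coprime d) (F : ℕ → M) :
    ∑ x ∈ Finset.Ico 1 p, F x = ∑ f ∈ Finset.range d, ∑ r ∈ residueClass p d f, F r :=
  prod_Ico_eq_prod_residueClass (M := Multiplicative M) hd hpd F

theorem residueClass_one (p : ℕ) : residueClass p 1 0 = Finset.Ico 1 p := by
  simp [residueClass]

theorem classSum_one (p k : ℕ) : classSum p 1 k 0 = ∑ r ∈ Finset.Ico 1 p, 1 / (r : ℚ) ^ k := by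
  rw [classSum, residueClass_one]

theorem sum_classSum {p d : ℕ} (hd : 0 < d) (hpd : p.Coprime d) (k : ℕ) :
    ∑ f ∈ Finset.range d, classSum p d k f = classSum p 1 k 0 := by
  rw [classSum_one, sum_Ico_eq_sum_residueClass hd hpd]
  rfl

/-- If r ≡ -fp, then p - r ≡ (f+1)p ≡ -(d-1-f)p mod d. -/
theorem classSum_reflect {p d f : ℕ} (hf : f < d) (k : ℕ) :
    classSum p d k (d - 1 - f) = ∑ r ∈ residueClass p d f, 1 / ((p : ℚ) - r) ^ k := by
  have key {f r : ℕ} (hf : f < d) (hr : r ∈ residueClass p d f) :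
      p - r ∈ residueClass p d (d - 1 - f) := by
    obtain ⟨⟨h1, h2⟩, h3⟩ := mem_residueClass.1 hr
    refine mem_residueClass.2 ⟨by omega, ?_⟩
    obtain ⟨e, rfl⟩ : ∃ e, d = f + 1 + e := ⟨d - (f + 1), by omega⟩
    rw [show f + 1 + e - 1 - f = e by omega]
    have h4 : p - r + e * p + (r + f * p) = (f + 1 + e) * p := by
      obtain ⟨q, rfl⟩ : ∃ q, p = r + q := ⟨p - r, by omega⟩
      rw [Nat.add_sub_cancel_left]; ring
    exact (Nat.dvd_add_left h3).1 (h4 ▸ dvd_mul_right _ _)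
  symm
  refine Finset.sum_bij' (fun r _ => p - r) (fun r _ => p - r) (fun r hr => key hf hr)
    (fun r hr => ?_) (fun r hr => ?_) (fun r hr => ?_) (fun r hr => ?_)
  · have := key (by omega) hr
    rwa [show d - 1 - (d - 1 - f) = f by omega] at this
  · have := (mem_residueClass.1 hr).1
    omega
  · have := (mem_residueClass.1 hr).1
    omega
  · have := (mem_residueClass.1 hr).1
    rw [Nat.cast_sub this.2.le]

/-- This refinement and the next two bring relations for different moduli to a common modulus, so
that they share the same unknowns. -/
theorem classSum_two_eq_four {p : ℕ} (hp : p % 2 = 1) (k : ℕ) :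
    classSum p 2 k 1 = classSum p 4 k 1 + classSum p 4 k 3 := by
  simp only [classSum, residueClass, Finset.sum_filter, ← Finset.sum_add_distrib]
  refine Finset.sum_congr rfl fun r _ => ?_
  split_ifs <;> first | (exfalso; omega) | simp

theorem classSum_two_eq_six {p : ℕ} (hp : p % 6 = 1 ∨ p % 6 = 5) (k : ℕ) :
    classSum p 2 k 1 = classSum p 6 k 1 + classSum p 6 k 3 + classSum p 6 k 5 := by
  simp only [classSum, residueClass, Finset.sum_filter, ← Finset.sum_add_distrib]
  refine Finset.sum_congr rfl fun r _ => ?_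
  split_ifs <;> first | (exfalso; omega) | simp

theorem classSum_three_eq_six {p f : ℕ} (hp : p % 6 = 1 ∨ p % 6 = 5) (hf : f = 1 ∨ f = 2) (k : ℕ) :
    classSum p 3 k f = classSum p 6 k f + classSum p 6 k (f + 3) := by
  simp only [classSum, residueClass, Finset.sum_filter, ← Finset.sum_add_distrib]
  refine Finset.sum_congr rfl fun r _ => ?_
  rcases hf with rfl | rfl <;> split_ifs <;> first | (exfalso; omega) | simp

/-! ### Reflection, Lerch's formula and dilation of power sums. -/

section

variable {p : ℕ} [hp : Fact p.Prime]

theorem inv_mem_of_mem_residueClass {d f r : ℕ} (hr : r ∈ residueClass p d f) :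
    (r : ℚ)⁻¹ ∈ ratPInt p :=
  inv_natCast_mem (not_dvd_of_mem_Ico (Finset.mem_filter.1 hr).1)

theorem ne_zero_of_mem_residueClass {p d f r : ℕ} (hr : r ∈ residueClass p d f) : (r : ℚ) ≠ 0 := by
  have := (mem_residueClass.1 hr).1
  exact Nat.cast_ne_zero.2 (by omega)

theorem inv_sub_mem_of_mem_residueClass {d f r : ℕ} (hr : r ∈ residueClass p d f) :
    ((p : ℚ) - r)⁻¹ ∈ ratPInt p := by
  have h := (mem_residueClass.1 hr).1
  rw [← Nat.cast_sub h.2.le]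
  exact inv_natCast_mem (not_dvd_of_mem_Ico (Finset.mem_Ico.2 ⟨by omega, by omega⟩))

theorem sub_ne_zero_of_mem_residueClass {p d f r : ℕ} (hr : r ∈ residueClass p d f) :
    (p : ℚ) - r ≠ 0 := by
  have h := (mem_residueClass.1 hr).1
  rw [← Nat.cast_sub h.2.le, Nat.cast_ne_zero]
  omega

/-- Expand 1/(p-r) = -1/r - p/r² - p²/r³ - ...; the witness is the exact remainder. The next two
lemmas expand the square and the cube. -/
theorem classSum_reflect_one {d f : ℕ} (hf : f < d) :
    classSum p d 1 (d - 1 - f) + classSum p d 1 f + p * classSum p d 2 f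
      + p ^ 2 * classSum p d 3 f ∈ pPow p 3 := by
  rw [classSum_reflect hf]
  simp only [classSum, Finset.mul_sum, ← Finset.sum_add_distrib]
  refine sum_mem fun r hr => mem_pPow.2 ⟨(r : ℚ)⁻¹ ^ 3 * ((p : ℚ) - r)⁻¹,
    mul_mem (pow_mem (inv_mem_of_mem_residueClass hr) 3) (inv_sub_mem_of_mem_residueClass hr), ?_⟩
  have := ne_zero_of_mem_residueClass hr
  have := sub_ne_zero_of_mem_residueClass hr
  field_simp
  ring

theorem classSum_reflect_two {d f : ℕ} (hf : f < d) :
    classSum p d 2 (d - 1 - f) - classSum p d 2 f - 2 * p * classSum p d 3 f ∈ pPow p 2 := by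
  rw [classSum_reflect hf]
  simp only [classSum, Finset.mul_sum, ← Finset.sum_sub_distrib]
  refine sum_mem fun r hr => mem_pPow.2 ⟨(3 * r - 2 * p) * (r : ℚ)⁻¹ ^ 3 * ((p : ℚ) - r)⁻¹ ^ 2,
    mul_mem (mul_mem (sub_mem (mul_mem (ofNat_mem _ 3) (natCast_mem _ r))
      (mul_mem (ofNat_mem _ 2) (natCast_mem _ p)))
      (pow_mem (inv_mem_of_mem_residueClass hr) 3))
      (pow_mem (inv_sub_mem_of_mem_residueClass hr) 2), ?_⟩
  have := ne_zero_of_mem_residueClass hr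
  have := sub_ne_zero_of_mem_residueClass hr
  field_simp
  ring

theorem classSum_reflect_three {d f : ℕ} (hf : f < d) :
    classSum p d 3 (d - 1 - f) + classSum p d 3 f ∈ pPow p 1 := by
  rw [classSum_reflect hf]
  simp only [classSum, ← Finset.sum_add_distrib]
  refine sum_mem fun r hr => mem_pPow.2 ⟨(p ^ 2 - 3 * p * r + 3 * r ^ 2) *
      (r : ℚ)⁻¹ ^ 3 * ((p : ℚ) - r)⁻¹ ^ 3,
    mul_mem (mul_mem ?_ (pow_mem (inv_mem_of_mem_residueClass hr) 3))
      (pow_mem (inv_sub_mem_of_mem_residueClass hr) 3), ?_⟩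
  · have h1 : (p : ℚ) ∈ ratPInt p := natCast_mem _ p
    have h2 : (r : ℚ) ∈ ratPInt p := natCast_mem _ r
    have h3 : (3 : ℚ) ∈ ratPInt p := ofNat_mem _ 3
    exact add_mem (sub_mem (pow_mem h1 2) (mul_mem (mul_mem h3 h1) h2)) (mul_mem h3 (pow_mem h2 2))
  have := ne_zero_of_mem_residueClass hr
  have := sub_ne_zero_of_mem_residueClass hr
  field_simp
  ring

/-- Lerch's formula for the Fermat quotient, modulo `p ^ 3`. -/
theorem truncLog_pow_sub_mem (h3 : 3 < p) {d : ℕ} (hd : 0 < d) (hpd : p.Coprime d) :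
    truncLog ((d : ℚ) ^ (p - 1)) / p - ∑ f ∈ Finset.range d, (f * classSum p d 1 f
      - p * (f ^ 2 / 2) * classSum p d 2 f + p ^ 2 * (f ^ 3 / 3) * classSum p d 3 f)
      ∈ pPow p 3 := by
  have hp0 : (p : ℚ) ≠ 0 := Nat.cast_ne_zero.2 hp.out.ne_zero
  -- The product of all dx equals both d^(p-1) Π x and Π (r + fp). Each r occurs exactly once, so Π
  -- x cancels.
  have hprod : (d : ℚ) ^ (p - 1) =
      ∏ y ∈ (Finset.range d).sigma fun f => residueClass p d f, (1 + (p : ℚ) * ((y.1 : ℚ) / y.2)) := by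
    have h1 := prod_Ico_mul_eq hd hpd (fun n => (n : ℚ))
    have h2 := prod_Ico_eq_prod_residueClass hd hpd (fun n => (n : ℚ))
    simp only [Nat.cast_mul, Finset.prod_mul_distrib, Finset.prod_const, Nat.card_Ico] at h1
    have h4 : ∏ f ∈ Finset.range d, ∏ r ∈ residueClass p d f, ((r + f * p : ℕ) : ℚ) =
        (∏ x ∈ Finset.Ico 1 p, (x : ℚ)) *
          ∏ f ∈ Finset.range d, ∏ r ∈ residueClass p d f, (1 + p * ((f : ℚ) / r)) := by
      rw [h2]
      simp only [← Finset.prod_mul_distrib]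
      refine Finset.prod_congr rfl fun f _ => Finset.prod_congr rfl fun r hr => ?_
      have := ne_zero_of_mem_residueClass hr
      push_cast
      field_simp
    rw [h4, mul_comm] at h1
    rw [← Finset.prod_sigma' _ _ fun f r : ℕ => (1 + (p : ℚ) * ((f : ℚ) / r))]
    refine mul_left_cancel₀ ?_ h1
    refine Finset.prod_ne_zero_iff.2 fun x hx => Nat.cast_ne_zero.2 ?_
    rw [Finset.mem_Ico] at hx; omega
  have hlog := (truncLog_prod h3 ((Finset.range d).sigma fun f => residueClass p d f)
    (fun y => 1 + (p : ℚ) * (y.1 / y.2)) fun y hy => by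
      refine mem_pPow.2 ⟨y.1 / y.2, ?_, by ring⟩
      rw [div_eq_mul_inv]
      exact mul_mem (natCast_mem _ _) (inv_mem_of_mem_residueClass (Finset.mem_sigma.1 hy).2)).2
  rw [← hprod, Finset.sum_sigma] at hlog
  -- The logarithm is known mod p⁴; dividing by p costs one power.
  refine mem_pPow_of_p_mul (m := 1) (n := 3) ?_
  convert hlog using 1
  rw [pow_one, mul_sub, mul_div_cancel₀ _ hp0]
  congr 1
  simp only [classSum, Finset.mul_sum, ← Finset.sum_add_distrib, ← Finset.sum_sub_distrib]
  refine Finset.sum_congr rfl fun f _ => Finset.sum_congr rfl fun r hr => ?_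
  rw [truncLog]
  have := ne_zero_of_mem_residueClass hr
  field_simp
  ring

/-- Expand Σ 1/(dx)² = Σ 1/(r+fp)² to first order in p. -/
theorem sum_mul_classSum_three {d : ℕ} (hd : ¬ p ∣ d) :
    (1 / (d : ℚ) ^ 2 - 1) * classSum p 1 2 0
      + 2 * p * ∑ f ∈ Finset.range d, f * classSum p d 3 f ∈ pPow p 2 := by
  have hd0 : 0 < d := Nat.pos_of_ne_zero (by rintro rfl; simp at hd)
  have hpd : p.Coprime d := (Nat.Prime.coprime_iff_not_dvd hp.out).2 hd
  have h1 := sum_Ico_mul_eq hd0 hpd (fun n => 1 / (n : ℚ) ^ 2)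
  have h2 := sum_Ico_eq_sum_residueClass hd0 hpd (fun n => 1 / (n : ℚ) ^ 2)
  have h3 : 1 / (d : ℚ) ^ 2 * classSum p 1 2 0 =
      ∑ x ∈ Finset.Ico 1 p, 1 / ((d * x : ℕ) : ℚ) ^ 2 := by
    rw [classSum_one, Finset.mul_sum]
    refine Finset.sum_congr rfl fun x _ => ?_
    push_cast
    rw [mul_pow, div_mul_div_comm, one_mul]
  rw [sub_mul, one_mul, h3, h1, classSum_one, h2]
  simp only [classSum, Finset.mul_sum, ← Finset.sum_add_distrib, ← Finset.sum_sub_distrib]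
  refine sum_mem fun f _ => sum_mem fun r hr => ?_
  have hr0 := ne_zero_of_mem_residueClass hr
  have hN : ¬ p ∣ r + f * p := by
    rw [Nat.dvd_add_left (dvd_mul_left p f)]
    exact not_dvd_of_mem_Ico (Finset.mem_filter.1 hr).1
  have hNi := inv_natCast_mem hN
  have hN0 : ((r + f * p : ℕ) : ℚ) ≠ 0 := Nat.cast_ne_zero.2 (by rintro h; simp [h] at hN)
  refine mem_pPow.2 ⟨f ^ 2 * (3 * r + 2 * f * p) * (r : ℚ)⁻¹ ^ 3 * ((r + f * p : ℕ) : ℚ)⁻¹ ^ 2,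
    ?_, ?_⟩
  · have h5 : (f : ℚ) ∈ ratPInt p := natCast_mem _ f
    have h6 : (r : ℚ) ∈ ratPInt p := natCast_mem _ r
    have h7 : (p : ℚ) ∈ ratPInt p := natCast_mem _ p
    exact mul_mem (mul_mem (mul_mem (pow_mem h5 2) (add_mem (mul_mem (ofNat_mem _ 3) h6)
      (mul_mem (mul_mem (ofNat_mem _ 2) h5) h7))) (pow_mem (inv_mem_of_mem_residueClass hr) 3))
      (pow_mem hNi 2)
  · push_cast at hN0 ⊢
    field_simp
    ring

end

/-! ### Bernoulli numbers and power sums. -/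

section

variable {p : ℕ} [hp : Fact p.Prime]

/-- The recursion for B_n divides only by n + 1, which is less than p. -/
theorem bernoulli_mem {n : ℕ} (hn : n < p - 1) : bernoulli n ∈ ratPInt p := by
  induction n using Nat.strong_induction_on with
  | _ n ih =>
    have h := sum_bernoulli (n + 1)
    rw [Finset.sum_range_succ, Nat.choose_succ_self_right] at h
    have h0 : ((n + 1 : ℕ) : ℚ) ≠ 0 := Nat.cast_ne_zero.2 n.succ_ne_zero
    have h1 : bernoulli n = ((n + 1 : ℕ) : ℚ)⁻¹ * ((if n + 1 = 1 then 1 else 0) -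
        ∑ k ∈ Finset.range n, ((n + 1).choose k : ℚ) * bernoulli k) := by
      rw [← h, add_sub_cancel_left, inv_mul_cancel_left₀ h0]
    rw [h1]
    refine mul_mem (inv_natCast_mem (not_dvd_of_mem_Ico (Finset.mem_Ico.2 (by omega))))
      (sub_mem ?_ (sum_mem fun k hk => ?_))
    · split_ifs
      exacts [one_mem _, zero_mem _]
    · have := Finset.mem_range.1 hk
      exact mul_mem (natCast_mem _ _) (ih k this (by omega))

/-- In Faulhaber's formula the top index gives p·B_{p-3}. All other terms carry at least p², and the
denominator p-2 is a unit. -/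
theorem sum_pow_sub_mem (h3 : 3 < p) :
    ∑ x ∈ Finset.Ico 1 p, (x : ℚ) ^ (p - 3) - p * bernoulli (p - 3) ∈ pPow p 2 := by
  obtain ⟨e, rfl⟩ : ∃ e, p = e + 3 := ⟨p - 3, by omega⟩
  have h := sum_range_pow (e + 3) e
  rw [Finset.range_eq_Ico, Finset.sum_eq_sum_Ico_succ_bot (by omega), Nat.cast_zero,
    zero_pow (by omega), zero_add, zero_add, Finset.sum_range_succ] at h
  have he : ((e : ℚ) + 1) ≠ 0 := by positivity
  have h2 : bernoulli e * ((e + 1).choose e : ℚ) * ((e + 3 : ℕ) : ℚ) ^ (e + 1 - e) / (e + 1) =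
      ((e + 3 : ℕ) : ℚ) * bernoulli e := by
    rw [Nat.choose_succ_self_right, Nat.add_sub_cancel_left]
    push_cast
    field_simp
  rw [Nat.add_sub_cancel, h, h2, add_sub_cancel_right]
  refine sum_mem fun i hi => ?_
  have hi := Finset.mem_range.1 hi
  obtain ⟨q, rfl⟩ : ∃ q, e = i + q + 1 := ⟨e - i - 1, by omega⟩
  refine mem_pPow.2 ⟨((i + q + 1 + 1 : ℕ) : ℚ)⁻¹ * (bernoulli i * ((i + q + 1 + 1).choose i : ℚ) *
    ((i + q + 1 + 3 : ℕ) : ℚ) ^ q), mul_mem ?_ (mul_mem (mul_mem ?_ ?_) (pow_mem ?_ _)), ?_⟩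
  · exact inv_natCast_mem (not_dvd_of_mem_Ico (Finset.mem_Ico.2 (by omega)))
  · exact bernoulli_mem (by omega)
  · exact natCast_mem _ _
  · exact natCast_mem _ _
  · rw [show i + q + 1 + 1 - i = 2 + q by omega, pow_add]
    push_cast
    field_simp

theorem pow_sub_inv_mem {n k : ℕ} (hn : ¬ p ∣ n) (hk : k < p) :
    (n : ℚ) ^ (p - 1 - k) - 1 / (n : ℚ) ^ k ∈ pPow p 1 := by
  have h := smul_mem_pPow (pow_mem (inv_natCast_mem hn) k) (natCast_pow_sub_one_mem hn)
  have hn0 : (n : ℚ) ≠ 0 := Nat.cast_ne_zero.2 (by rintro rfl; simp at hn)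
  convert h using 1
  rw [show p - 1 = p - 1 - k + k by omega, pow_add, Nat.add_sub_cancel, inv_pow]
  have := pow_ne_zero k hn0
  field_simp

/-- Expand Σ (dx)^(p-3) = Σ (r+fp)^(p-3) to first order in p, with r^(p-4) ≡ 1/r³ mod p. This yields
B_{p-3} where the dilation of Σ 1/n² yields Σ 1/n² itself. -/
theorem sum_mul_classSum_three_bernoulli (h3 : 3 < p) {d : ℕ} (hd : ¬ p ∣ d) :
    (1 / (d : ℚ) ^ 2 - 1) * bernoulli (p - 3)
      + 3 * ∑ f ∈ Finset.range d, f * classSum p d 3 f ∈ pPow p 1 := by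
  have hd0 : 0 < d := Nat.pos_of_ne_zero (by rintro rfl; simp at hd)
  have hpd : p.Coprime d := (Nat.Prime.coprime_iff_not_dvd hp.out).2 hd
  have hP : (p : ℚ) ∈ ratPInt p := natCast_mem _ p
  set s := ∑ x ∈ Finset.Ico 1 p, (x : ℚ) ^ (p - 3) with hs
  have hsB := sum_pow_sub_mem h3
  rw [← hs] at hsB
  have hB : bernoulli (p - 3) ∈ ratPInt p := bernoulli_mem (by omega)
  have hs1 : s ∈ pPow p 1 := by
    have h1 := mem_pPow_of_le (show 1 ≤ 2 by norm_num) hsB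
    have h2 : (p : ℚ) * bernoulli (p - 3) ∈ pPow p 1 := mem_pPow.2 ⟨_, hB, by ring⟩
    simpa using add_mem h1 h2
  have hd2 : (d : ℚ) ^ (p - 3) - 1 / (d : ℚ) ^ 2 ∈ pPow p 1 := by
    have := pow_sub_inv_mem hd (k := 2) (by omega)
    rwa [show p - 1 - 2 = p - 3 by omega] at this
  have hdi : 1 / (d : ℚ) ^ 2 ∈ ratPInt p := by
    rw [one_div, ← inv_pow]; exact pow_mem (inv_natCast_mem hd) 2
  have h1 := sum_Ico_mul_eq hd0 hpd (fun n => (n : ℚ) ^ (p - 3))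
  have h2 := sum_Ico_eq_sum_residueClass hd0 hpd (fun n => (n : ℚ) ^ (p - 3))
  have h4 : (d : ℚ) ^ (p - 3) * s = ∑ x ∈ Finset.Ico 1 p, ((d * x : ℕ) : ℚ) ^ (p - 3) := by
    rw [Finset.mul_sum]
    exact Finset.sum_congr rfl fun x _ => by push_cast; rw [mul_pow]
  have h5 : (d : ℚ) ^ (p - 3) * s - s + 3 * p * ∑ f ∈ Finset.range d, f * classSum p d 3 f
      ∈ pPow p 2 := by
    rw [h4, h1, hs, h2]
    simp only [classSum, Finset.mul_sum, ← Finset.sum_add_distrib, ← Finset.sum_sub_distrib]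
    refine sum_mem fun f _ => sum_mem fun r hr => ?_
    have hf : (f : ℚ) ∈ ratPInt p := natCast_mem _ f
    obtain ⟨k, hk⟩ := Polynomial.powAddExpansion r (f * p) (p - 3)
    have hk' : ((r + f * p : ℕ) : ℚ) ^ (p - 3) = (r : ℚ) ^ (p - 3) +
        (p - 3) * r ^ (p - 1 - 3) * (f * p) + k * (f * p) ^ 2 := by
      have := congrArg (Nat.cast : ℕ → ℚ) hk
      rw [show p - 3 - 1 = p - 1 - 3 by omega] at this
      push_cast [Nat.cast_sub h3.le] at this ⊢
      exact this
    obtain ⟨c, hc, hc'⟩ := mem_pPow.1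
      (pow_sub_inv_mem (not_dvd_of_mem_Ico (Finset.mem_filter.1 hr).1) (k := 3) (by omega))
    rw [sub_eq_iff_eq_add] at hc'
    rw [hk', hc']
    refine mem_pPow.2 ⟨f * (p * c - 3 * c + (r : ℚ)⁻¹ ^ 3) + k * f ^ 2, add_mem (mul_mem hf (add_mem
      (sub_mem (mul_mem hP hc) (mul_mem (ofNat_mem _ 3) hc))
      (pow_mem (inv_mem_of_mem_residueClass hr) 3))) (mul_mem (natCast_mem _ k) (pow_mem hf 2)), ?_⟩
    have := ne_zero_of_mem_residueClass hr
    field_simp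
    ring
  -- Replace d^(p-3) by 1/d², which is allowed mod p² because p ∣ s, then s by p·B_{p-3}, and
  -- finally cancel one factor p.
  have h6 := sub_mem h5 (mul_mem_pPow hd2 hs1)
  have h7 := sub_mem h6 (smul_mem_pPow (sub_mem hdi (one_mem _)) hsB)
  refine mem_pPow_of_p_mul (m := 1) (n := 1) ?_
  convert h7 using 1
  ring

theorem classSum_two_three_one (h3 : 3 < p) :
    classSum p 2 3 1 - 1 / 4 * bernoulli (p - 3) ∈ pPow p 1 := by
  have h := smul_mem_pPow (third_mem h3) (sum_mul_classSum_three_bernoulli h3 (not_dvd_two h3))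
  simp only [Finset.sum_range_succ, Finset.sum_range_zero] at h
  convert h using 1
  push_cast
  ring

/-- At d = 2 only f = 1 contributes to either dilation relation; eliminating that class sum leaves Σ
1/r² in terms of B_{p-3}. -/
theorem classSum_one_two (h3 : 3 < p) :
    classSum p 1 2 0 - 2 / 3 * p * bernoulli (p - 3) ∈ pPow p 2 := by
  have h := sum_mul_classSum_three (p := p) (not_dvd_two h3)
  simp only [Finset.sum_range_succ, Finset.sum_range_zero] at h
  have h1 := p_mul_mem_pPow 1 (classSum_two_three_one h3)
  have h2 := smul_mem_pPow (mem_of_den_six h3 (c := -4 / 3) (-8) 1 (by norm_num)) h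
  have h4 := smul_mem_pPow (mem_of_den_six h3 (c := 8 / 3) 16 1 (by norm_num)) h1
  convert add_mem h2 h4 using 1
  push_cast
  ring

/-- For d = 1 the reflection fixes the only class, so twice the sum vanishes mod p. -/
theorem classSum_one_three : classSum p 1 3 0 + classSum p 1 3 0 ∈ pPow p 1 :=
  classSum_reflect_three (d := 1) (f := 0) one_pos

end

/-! ### Reduction of S(-r/d) to sums over one residue class. -/

theorem sum_residueClass_pred {p d m r : ℕ} (hp : p = d * m + r) (hr : 0 < r) (hrd : r ≤ d)
    (F : ℕ → ℚ) :
    ∑ x ∈ residueClass p d (d - 1), F x = ∑ i ∈ Finset.range m, F (p - d * (i + 1)) := by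
  have hd : 0 < d := by omega
  have hlt {i : ℕ} (hi : i < m) : d * (i + 1) + r ≤ p := by
    have := Nat.mul_le_mul_left d (show i + 1 ≤ m from hi)
    omega
  have key {x : ℕ} (hx : x ∈ residueClass p d (d - 1)) : d ∣ p - x := by
    obtain ⟨⟨h1, h2⟩, h4⟩ := mem_residueClass.1 hx
    have h5 : p - x + (x + (d - 1) * p) = d * p := by
      obtain ⟨e, rfl⟩ : ∃ e, d = e + 1 := ⟨d - 1, by omega⟩
      rw [Nat.add_sub_cancel, ← add_assoc, Nat.sub_add_cancel h2.le]; ring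
    exact (Nat.dvd_add_left h4).1 (h5 ▸ dvd_mul_right d p)
  symm
  refine Finset.sum_bij' (fun i _ => p - d * (i + 1)) (fun x _ => (p - x) / d - 1) ?_ ?_ ?_ ?_ ?_
  · intro i hi
    have h1 := hlt (Finset.mem_range.1 hi)
    have h2 : 0 < d * (i + 1) := by positivity
    refine mem_residueClass.2 ⟨by omega, ?_⟩
    have h4 : p - d * (i + 1) + (d - 1) * p + d * (i + 1) = d * p := by
      obtain ⟨e, rfl⟩ : ∃ e, d = e + 1 := ⟨d - 1, by omega⟩
      rw [Nat.add_sub_cancel, add_right_comm, Nat.sub_add_cancel (by omega)]; ring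
    exact (Nat.dvd_add_left (dvd_mul_right d (i + 1))).1 (h4 ▸ dvd_mul_right d p)
  · intro x hx
    obtain ⟨⟨h1, h2⟩, h4⟩ := mem_residueClass.1 hx
    obtain ⟨c, hc⟩ := key hx
    have hc0 : c ≠ 0 := by rintro rfl; omega
    have hcm : c < m + 1 := by
      refine lt_of_mul_lt_mul_left (a := d) ?_ hd.le
      rw [mul_add]; omega
    rw [hc, Nat.mul_div_cancel_left _ hd, Finset.mem_range]
    omega
  · intro i hi
    have h1 := hlt (Finset.mem_range.1 hi)
    rw [Nat.sub_sub_self (by omega), Nat.mul_div_cancel_left _ hd, Nat.add_sub_cancel]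
  · intro x hx
    obtain ⟨⟨h1, h2⟩, h4⟩ := mem_residueClass.1 hx
    obtain ⟨c, hc⟩ := key hx
    have hc0 : c ≠ 0 := by rintro rfl; omega
    rw [hc, Nat.mul_div_cancel_left _ hd, Nat.sub_add_cancel (by omega), ← hc]
    omega
  · intros
    rfl

section

variable {p : ℕ} [hp : Fact p.Prime]

/-- At s = -p/d each sine product is 1 mod p² and s supplies a third p. What remains is -sΣ1/j² -
s²Σ1/j³, whose second sum vanishes mod p. -/
theorem chooseSum_neg_div_mem (h3 : 3 < p) {d : ℕ} (hd : ¬ p ∣ d) :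
    chooseSum (-(p / d : ℚ)) (p - 1) - 2 / (3 * d) * p ^ 2 * bernoulli (p - 3) ∈ pPow p 3 := by
  have hd0 : (d : ℚ) ≠ 0 := by rintro h; apply hd; simp [Nat.cast_eq_zero.1 h]
  have hdi := inv_natCast_mem hd
  set s : ℚ := -(p / d : ℚ) with hs
  have hs1 : s ∈ pPow p 1 := mem_pPow.2 ⟨-(d : ℚ)⁻¹, neg_mem hdi, by rw [hs]; ring⟩
  have h1 : chooseSum s (p - 1) + s * classSum p 1 2 0 + s * s * classSum p 1 3 0 ∈ pPow p 3 := by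
    rw [classSum_one, classSum_one, Finset.sum_Ico_eq_sum_range, Finset.sum_Ico_eq_sum_range]
    simp only [chooseSum, Finset.mul_sum, ← Finset.sum_add_distrib]
    refine sum_mem fun k hk => ?_
    have h2 := sineProd_sub_one_mem (n := k) (Finset.mem_range.1 hk).le hs1
    have hki := inv_succ_mem hk
    have h4 := mul_mem_pPow (smul_mem_pPow (neg_mem (mul_mem (add_mem (ratPInt_of_mem_pPow hs1)
      (add_mem (natCast_mem _ k) (one_mem _))) (pow_mem hki 3))) hs1) h2
    convert h4 using 1
    rw [chooseProd_succ_eq_sineProd]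
    have hk0 : (k : ℚ) + 1 ≠ 0 := by positivity
    push_cast
    rw [add_comm 1 (k : ℚ)]
    field_simp
    ring
  have h2 := mul_mem_pPow hs1 (classSum_one_two h3)
  have h4 := mul_mem_pPow (mul_mem_pPow hs1 hs1)
    (smul_mem_pPow (half_mem h3) (classSum_one_three (p := p)))
  convert sub_mem (sub_mem h1 h4) h2 using 1
  rw [hs]
  field_simp
  ring

theorem chooseSum_mem (h3 : 3 < p) {d m r : ℕ} (hd : ¬ p ∣ d) (hpd : p = d * m + r)
    (hr : 0 < r) (hrd : r ≤ d) :
    chooseSum (-(r / d : ℚ)) (p - 1) - (2 * d * classSum p d 1 (d - 1)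
      + 2 * d * (d - 1) * p ^ 2 * classSum p d 3 (d - 1)
      + 2 / (3 * d) * p ^ 2 * bernoulli (p - 3)) ∈ pPow p 3 := by
  have hd0 : (d : ℚ) ≠ 0 := by rintro h; apply hd; simp [Nat.cast_eq_zero.1 h]
  have hdi := inv_natCast_mem hd
  have hlt {i : ℕ} (hi : i < m) : d * (i + 1) < p := by
    have := Nat.mul_le_mul_left d (show i + 1 ≤ m from hi)
    omega
  have hcast {i : ℕ} (hi : i < m) : ((p - d * (i + 1) : ℕ) : ℚ) = p - d * (i + 1) := by
    rw [Nat.cast_sub (hlt hi).le]; push_cast; rfl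
  have hndvd {i : ℕ} (hi : i < m) : ¬ p ∣ p - d * (i + 1) := by
    have : 0 < d * (i + 1) := mul_pos (by omega) i.succ_pos
    exact not_dvd_of_mem_Ico (Finset.mem_Ico.2 ⟨by have := hlt hi; omega, by omega⟩)
  have hb {i : ℕ} (hi : i < m) :
      -(p / d : ℚ) + (i + 1) = -(((p - d * (i + 1) : ℕ) : ℚ) / d) := by
    rw [hcast hi]; field_simp; ring
  have hne {i : ℕ} (hi : i < m) : ((p - d * (i + 1) : ℕ) : ℚ) ≠ 0 :=
    Nat.cast_ne_zero.2 (by have := hlt hi; omega)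
  have ha : -(r / d : ℚ) = -(p / d : ℚ) + m := by
    have : (p : ℚ) = d * m + r := by exact_mod_cast hpd
    rw [this]; field_simp; ring
  rw [ha, chooseSum_add _ _ _ fun i hi => by
    rw [hb (Finset.mem_range.1 hi)]
    exact neg_ne_zero.2 (div_ne_zero (hne (Finset.mem_range.1 hi)) hd0)]
  have key : ∑ i ∈ Finset.range m, 2 / (-(p / d : ℚ) + (i + 1)) *
      (sineProd (-(p / d : ℚ) + (i + 1)) (p - 1) - 1) - (2 * d * classSum p d 1 (d - 1)
      + 2 * d * (d - 1) * p ^ 2 * classSum p d 3 (d - 1)) ∈ pPow p 3 := by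
    simp only [classSum]
    rw [sum_residueClass_pred hpd hr hrd, sum_residueClass_pred hpd hr hrd]
    simp only [Finset.mul_sum, ← Finset.sum_add_distrib, ← Finset.sum_sub_distrib]
    refine sum_mem fun i hi => ?_
    have hi := Finset.mem_range.1 hi
    have h1 := sineProd_mem hd i hi (show d * m < p by omega)
    simp only at h1
    rw [hb hi] at h1 ⊢
    obtain ⟨h2, h4⟩ := neg_div_sub_inv_mem hd (hndvd hi)
    have h0 := hne hi
    have hxi := inv_natCast_mem (hndvd hi)
    set x : ℚ := ((p - d * (i + 1) : ℕ) : ℚ) with hx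
    -- With a = -x/d, 2P(a)/a is a(a-p)P(a) times 2(d/x)²/(a-p). `h5` replaces a(a-p)P(a) by its
    -- value mod p³; `h6` then replaces 1/(a²(a-p)) by 1/a³, at the cost of a further factor p.
    have h5 := smul_mem_pPow (mul_mem (mul_mem (ofNat_mem _ 2) (pow_mem (mul_mem
      (natCast_mem _ d) hxi) 2)) h4) h1
    have h6 := pPow_mul_mem (n := 3) (mul_mem (mul_mem (mul_mem (mul_mem (ofNat_mem _ 2)
      (sub_mem (natCast_mem (ratPInt p) d) (one_mem _))) (natCast_mem _ d)) (pow_mem hxi 3)) h4)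
    convert add_mem h5 h6 using 1
    generalize sineProd (-(x / d)) (p - 1) = t
    -- Solving for p makes the denominators x and a-p into atoms that `field_simp` can clear.
    generalize hy : -(x / d) - (p : ℚ) = y at h2
    obtain hy : (p : ℚ) = -(x / d) - y := by linarith
    rw [hy]
    field_simp
    ring
  convert add_mem (chooseSum_neg_div_mem h3 hd) key using 1
  ring

end

/-! ### Evaluation of the class sums for d = 2, 3, 4, 6. -/

theorem classSum_two_one_zero {p : ℕ} (hp2 : p % 2 = 1) :
    2 * classSum p 2 1 0 = harmonic ((p - 1) / 2) := by
  rw [classSum, harmonic, Finset.mul_sum]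
  refine Finset.sum_bij' (fun r _ => r / 2 - 1) (fun i _ => 2 * (i + 1)) ?_ ?_ ?_ ?_ ?_
  · intro r hr
    have := mem_residueClass.1 hr
    rw [Finset.mem_range]
    omega
  · intro i hi
    have := Finset.mem_range.1 hi
    rw [mem_residueClass]
    omega
  · intro r hr
    have := mem_residueClass.1 hr
    omega
  · intro i hi
    omega
  · intro r hr
    have := mem_residueClass.1 hr
    obtain ⟨k, rfl⟩ : ∃ k, r = 2 * (k + 1) := ⟨r / 2 - 1, by omega⟩
    rw [Nat.mul_div_cancel_left _ two_pos, Nat.add_sub_cancel]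
    push_cast
    field_simp

section

variable {p : ℕ} [hp : Fact p.Prime]

theorem coprime_of_not_dvd {d : ℕ} (hd : ¬ p ∣ d) : p.Coprime d :=
  (Nat.Prime.coprime_iff_not_dvd hp.out).2 hd

theorem not_dvd_four (h3 : 3 < p) : ¬ p ∣ 4 := fun h =>
  not_dvd_two h3 (hp.out.dvd_of_dvd_pow (show p ∣ 2 ^ 2 from h))

theorem not_dvd_six (h3 : 3 < p) : ¬ p ∣ 6 := fun h =>
  ((hp.out.dvd_mul).1 (show p ∣ 2 * 3 from h)).elim (not_dvd_two h3) (not_dvd_three h3)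

theorem mod_six (h3 : 3 < p) : p % 6 = 1 ∨ p % 6 = 5 := by
  have h1 := (Nat.prime_dvd_prime_iff_eq Nat.prime_two hp.out).not.2 (by omega)
  have h2 := (Nat.prime_dvd_prime_iff_eq Nat.prime_three hp.out).not.2 (by omega)
  omega

theorem add_smul_mem_pPow {n : ℕ} {x c y : ℚ} (hx : x ∈ pPow p n) (hc : c ∈ ratPInt p)
    (hy : y ∈ pPow p n) : x + c * y ∈ pPow p n :=
  add_mem hx (smul_mem_pPow hc hy)

theorem truncLog_mul_pow (h3 : 3 < p) {a b : ℕ} (ha : ¬ p ∣ a) (hb : ¬ p ∣ b) :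
    truncLog (((a : ℚ) * b) ^ (p - 1)) / p - (truncLog ((a : ℚ) ^ (p - 1)) / p +
      truncLog ((b : ℚ) ^ (p - 1)) / p) ∈ pPow p 3 := by
  refine mem_pPow_of_p_mul (m := 1) (n := 3) ?_
  have hp0 : (p : ℚ) ≠ 0 := Nat.cast_ne_zero.2 hp.out.ne_zero
  convert truncLog_mul h3 (natCast_pow_sub_one_mem ha) (natCast_pow_sub_one_mem hb) using 1
  rw [mul_pow]
  field_simp

theorem truncLog_four (h3 : 3 < p) : truncLog (4 ^ (p - 1)) / p
    - 2 * (truncLog (2 ^ (p - 1)) / p) ∈ pPow p 3 := by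
  have h := truncLog_mul_pow h3 (not_dvd_two h3) (not_dvd_two h3)
  push_cast at h
  rwa [show (2 * 2 : ℚ) = 4 by norm_num, ← two_mul] at h

theorem truncLog_six (h3 : 3 < p) : truncLog (6 ^ (p - 1)) / p
    - (truncLog (2 ^ (p - 1)) / p + truncLog (3 ^ (p - 1)) / p) ∈ pPow p 3 := by
  have h := truncLog_mul_pow h3 (not_dvd_two h3) (not_dvd_three h3)
  push_cast at h
  rwa [show (2 * 3 : ℚ) = 6 by norm_num] at h

theorem three_classSum_mem (h3 : 3 < p) :
    2 * 3 * classSum p 3 1 2 + 2 * 3 * (3 - 1) * p ^ 2 * classSum p 3 3 2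
      + 2 / (3 * 3) * p ^ 2 * bernoulli (p - 3)
      - (3 * (truncLog (3 ^ (p - 1)) / p) + 52 / 27 * (p : ℚ) ^ 2 * bernoulli (p - 3)) ∈ pPow p 3 := by
  have r2_0 := p_mul_mem_pPow 1 (classSum_reflect_two (p := p) (d := 3) (f := 0) (by norm_num))
  have r3_0 := p_mul_mem_pPow 2 (classSum_reflect_three (p := p) (d := 3) (f := 0) (by norm_num))
  have r1_1 := classSum_reflect_one (p := p) (d := 3) (f := 1) (by norm_num)
  have r3_1 := p_mul_mem_pPow 2 (classSum_reflect_three (p := p) (d := 3) (f := 1) (by norm_num))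
  have s2 := p_mul_mem_pPow 1 (classSum_one_two (p := p) h3)
  rw [← sum_classSum (d := 3) (by norm_num) (coprime_of_not_dvd (not_dvd_three h3))] at s2
  have l3 := truncLog_pow_sub_mem h3 (d := 3) (by norm_num) (coprime_of_not_dvd (not_dvd_three h3))
  have c3 := p_mul_mem_pPow 2 (sum_mul_classSum_three_bernoulli h3 (not_dvd_three h3))
  simp only [Finset.sum_range_succ, Finset.sum_range_zero] at s2 l3 c3
  simp only [Nat.reduceSub, Nat.reduceAdd] at r2_0 r3_0 r1_1 r3_1 s2 c3
  -- The class sums are treated as unknowns. The constants c solve the linear system that writes the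
  -- target as a combination of the relations, each already scaled by a power of p to hold mod p³.
  -- The other two arguments certify c = z/6ⁿ. The lemmas for d = 4, 6 and 2 follow the same scheme.
  have key := zero_mem (pPow p 3)
  replace key := add_smul_mem_pPow key (mem_of_den_six h3 (c := 3) (3) 0 (by norm_num)) r2_0
  replace key := add_smul_mem_pPow key (mem_of_den_six h3 (c := 6) (6) 0 (by norm_num)) r3_0
  replace key := add_smul_mem_pPow key (mem_of_den_six h3 (c := -3/2) (-9) 1 (by norm_num)) r1_1
  replace key := add_smul_mem_pPow key (mem_of_den_six h3 (c := 3/4) (27) 2 (by norm_num)) r3_1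
  replace key := add_smul_mem_pPow key (mem_of_den_six h3 (c := 3) (3) 0 (by norm_num)) s2
  replace key := add_smul_mem_pPow key (mem_of_den_six h3 (c := -3) (-3) 0 (by norm_num)) l3
  replace key := add_smul_mem_pPow key (mem_of_den_six h3 (c := -1/3) (-2) 1 (by norm_num)) c3
  convert key using 1
  push_cast
  ring

theorem four_classSum_mem (h3 : 3 < p) :
    2 * 4 * classSum p 4 1 3 + 2 * 4 * (4 - 1) * p ^ 2 * classSum p 4 3 3
      + 2 / (3 * 4) * p ^ 2 * bernoulli (p - 3)
      - (6 * (truncLog (2 ^ (p - 1)) / p) + 7 / 2 * (p : ℚ) ^ 2 * bernoulli (p - 3)) ∈ pPow p 3 := by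
  have r2_0 := p_mul_mem_pPow 1 (classSum_reflect_two (p := p) (d := 4) (f := 0) (by norm_num))
  have r3_0 := p_mul_mem_pPow 2 (classSum_reflect_three (p := p) (d := 4) (f := 0) (by norm_num))
  have r1_1 := classSum_reflect_one (p := p) (d := 4) (f := 1) (by norm_num)
  have r2_1 := p_mul_mem_pPow 1 (classSum_reflect_two (p := p) (d := 4) (f := 1) (by norm_num))
  have s2 := p_mul_mem_pPow 1 (classSum_one_two (p := p) h3)
  rw [← sum_classSum (d := 4) (by norm_num) (coprime_of_not_dvd (not_dvd_four h3))] at s2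
  have l2 := truncLog_pow_sub_mem h3 (d := 2) (by norm_num) (coprime_of_not_dvd (not_dvd_two h3))
  have c2 := p_mul_mem_pPow 2 (sum_mul_classSum_three_bernoulli h3 (not_dvd_two h3))
  have l4 := truncLog_pow_sub_mem h3 (d := 4) (by norm_num) (coprime_of_not_dvd (not_dvd_four h3))
  have c4 := p_mul_mem_pPow 2 (sum_mul_classSum_three_bernoulli h3 (not_dvd_four h3))
  have hLL := truncLog_four (p := p) h3
  simp only [Finset.sum_range_succ, Finset.sum_range_zero] at s2 l2 c2 l4 c4
  simp only [Nat.reduceSub, Nat.reduceAdd] at r2_0 r3_0 r1_1 r2_1 s2 c2 c4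
  have hodd : p % 2 = 1 := by have := mod_six h3; omega
  simp only [classSum_two_eq_four hodd] at l2 c2
  have key := zero_mem (pPow p 3)
  replace key := add_smul_mem_pPow key (mem_of_den_six h3 (c := 5) (5) 0 (by norm_num)) r2_0
  replace key := add_smul_mem_pPow key (mem_of_den_six h3 (c := 10) (10) 0 (by norm_num)) r3_0
  replace key := add_smul_mem_pPow key (mem_of_den_six h3 (c := -4) (-4) 0 (by norm_num)) r1_1
  replace key := add_smul_mem_pPow key (mem_of_den_six h3 (c := -1) (-1) 0 (by norm_num)) r2_1
  replace key := add_smul_mem_pPow key (mem_of_den_six h3 (c := 5) (5) 0 (by norm_num)) s2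
  replace key := add_smul_mem_pPow key (mem_of_den_six h3 (c := -2) (-2) 0 (by norm_num)) l2
  replace key := add_smul_mem_pPow key (mem_of_den_six h3 (c := 10/9) (40) 2 (by norm_num)) c2
  replace key := add_smul_mem_pPow key (mem_of_den_six h3 (c := -2) (-2) 0 (by norm_num)) l4
  replace key := add_smul_mem_pPow key (mem_of_den_six h3 (c := -8/9) (-32) 2 (by norm_num)) c4
  replace key := add_smul_mem_pPow key (mem_of_den_six h3 (c := 2) (2) 0 (by norm_num)) hLL
  convert key using 1
  push_cast
  ring

theorem six_classSum_mem (h3 : 3 < p) :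
    2 * 6 * classSum p 6 1 5 + 2 * 6 * (6 - 1) * p ^ 2 * classSum p 6 3 5
      + 2 / (3 * 6) * p ^ 2 * bernoulli (p - 3)
      - (4 * (truncLog (2 ^ (p - 1)) / p) + 3 * (truncLog (3 ^ (p - 1)) / p) + 455 / 54 * (p : ℚ) ^ 2 * bernoulli (p - 3)) ∈ pPow p 3 := by
  have r2_0 := p_mul_mem_pPow 1 (classSum_reflect_two (p := p) (d := 6) (f := 0) (by norm_num))
  have r3_0 := p_mul_mem_pPow 2 (classSum_reflect_three (p := p) (d := 6) (f := 0) (by norm_num))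
  have r1_1 := classSum_reflect_one (p := p) (d := 6) (f := 1) (by norm_num)
  have r3_1 := p_mul_mem_pPow 2 (classSum_reflect_three (p := p) (d := 6) (f := 1) (by norm_num))
  have r1_2 := classSum_reflect_one (p := p) (d := 6) (f := 2) (by norm_num)
  have r2_2 := p_mul_mem_pPow 1 (classSum_reflect_two (p := p) (d := 6) (f := 2) (by norm_num))
  have r3_2 := p_mul_mem_pPow 2 (classSum_reflect_three (p := p) (d := 6) (f := 2) (by norm_num))
  have s2 := p_mul_mem_pPow 1 (classSum_one_two (p := p) h3)
  rw [← sum_classSum (d := 6) (by norm_num) (coprime_of_not_dvd (not_dvd_six h3))] at s2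
  have l2 := truncLog_pow_sub_mem h3 (d := 2) (by norm_num) (coprime_of_not_dvd (not_dvd_two h3))
  have c2 := p_mul_mem_pPow 2 (sum_mul_classSum_three_bernoulli h3 (not_dvd_two h3))
  have l3 := truncLog_pow_sub_mem h3 (d := 3) (by norm_num) (coprime_of_not_dvd (not_dvd_three h3))
  have c3 := p_mul_mem_pPow 2 (sum_mul_classSum_three_bernoulli h3 (not_dvd_three h3))
  have l6 := truncLog_pow_sub_mem h3 (d := 6) (by norm_num) (coprime_of_not_dvd (not_dvd_six h3))
  have c6 := p_mul_mem_pPow 2 (sum_mul_classSum_three_bernoulli h3 (not_dvd_six h3))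
  have hLL := truncLog_six (p := p) h3
  simp only [Finset.sum_range_succ, Finset.sum_range_zero] at s2 l2 c2 l3 c3 l6 c6
  simp only [Nat.reduceSub, Nat.reduceAdd] at r2_0 r3_0 r1_1 r3_1 r1_2 r2_2 r3_2 s2 c2 c3 c6
  have h6 := mod_six h3
  -- The class f = 0 needs no splitting: its weight in `l3` and `c3` is zero.
  have m1 := classSum_three_eq_six (f := 1) h6 (.inl rfl)
  have m2 := classSum_three_eq_six (f := 2) h6 (.inr rfl)
  simp only [classSum_two_eq_six h6] at l2 c2
  simp only [m1, m2, Nat.reduceAdd] at l3 c3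
  have key := zero_mem (pPow p 3)
  replace key := add_smul_mem_pPow key (mem_of_den_six h3 (c := 9) (9) 0 (by norm_num)) r2_0
  replace key := add_smul_mem_pPow key (mem_of_den_six h3 (c := 18) (18) 0 (by norm_num)) r3_0
  replace key := add_smul_mem_pPow key (mem_of_den_six h3 (c := -6) (-6) 0 (by norm_num)) r1_1
  replace key := add_smul_mem_pPow key (mem_of_den_six h3 (c := -6) (-6) 0 (by norm_num)) r3_1
  replace key := add_smul_mem_pPow key (mem_of_den_six h3 (c := -6) (-6) 0 (by norm_num)) r1_2
  replace key := add_smul_mem_pPow key (mem_of_den_six h3 (c := -3) (-3) 0 (by norm_num)) r2_2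
  replace key := add_smul_mem_pPow key (mem_of_den_six h3 (c := -6) (-6) 0 (by norm_num)) r3_2
  replace key := add_smul_mem_pPow key (mem_of_den_six h3 (c := 9) (9) 0 (by norm_num)) s2
  replace key := add_smul_mem_pPow key (mem_of_den_six h3 (c := -3) (-3) 0 (by norm_num)) l2
  replace key := add_smul_mem_pPow key (mem_of_den_six h3 (c := 11/3) (22) 1 (by norm_num)) c2
  replace key := add_smul_mem_pPow key (mem_of_den_six h3 (c := -2) (-2) 0 (by norm_num)) l3
  replace key := add_smul_mem_pPow key (mem_of_den_six h3 (c := 4/3) (8) 1 (by norm_num)) c3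
  replace key := add_smul_mem_pPow key (mem_of_den_six h3 (c := -1) (-1) 0 (by norm_num)) l6
  replace key := add_smul_mem_pPow key (mem_of_den_six h3 (c := -5/3) (-10) 1 (by norm_num)) c6
  replace key := add_smul_mem_pPow key (mem_of_den_six h3 (c := 1) (1) 0 (by norm_num)) hLL
  convert key using 1
  push_cast
  ring

/-- The class f = 0 for d = 2 consists of the even r, so its sum is half a harmonic number; this
links the Fermat quotient form to Sun's. -/
theorem two_classSum_mem (h3 : 3 < p) :
    6 * (truncLog (2 ^ (p - 1)) / p) + 7 / 4 * (p : ℚ) ^ 2 * bernoulli (p - 3)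
      + 6 * classSum p 2 1 0 ∈ pPow p 3 := by
  have r1_1 := classSum_reflect_one (p := p) (d := 2) (f := 1) (by norm_num)
  have r2_1 := p_mul_mem_pPow 1 (classSum_reflect_two (p := p) (d := 2) (f := 1) (by norm_num))
  have s2 := p_mul_mem_pPow 1 (classSum_one_two (p := p) h3)
  rw [← sum_classSum (d := 2) (by norm_num) (coprime_of_not_dvd (not_dvd_two h3))] at s2
  have l2 := truncLog_pow_sub_mem h3 (d := 2) (by norm_num) (coprime_of_not_dvd (not_dvd_two h3))
  have c2 := p_mul_mem_pPow 2 (sum_mul_classSum_three_bernoulli h3 (not_dvd_two h3))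
  simp only [Finset.sum_range_succ, Finset.sum_range_zero] at s2 l2 c2
  simp only [Nat.reduceSub, Nat.reduceAdd] at r1_1 r2_1 s2 c2
  have key := zero_mem (pPow p 3)
  replace key := add_smul_mem_pPow key (mem_of_den_six h3 (c := 6) (6) 0 (by norm_num)) r1_1
  replace key := add_smul_mem_pPow key (mem_of_den_six h3 (c := 9/2) (27) 1 (by norm_num)) r2_1
  replace key := add_smul_mem_pPow key (mem_of_den_six h3 (c := -9/2) (-27) 1 (by norm_num)) s2
  replace key := add_smul_mem_pPow key (mem_of_den_six h3 (c := 6) (6) 0 (by norm_num)) l2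
  replace key := add_smul_mem_pPow key (mem_of_den_six h3 (c := 5/3) (10) 1 (by norm_num)) c2
  convert key using 1
  push_cast
  ring

/-- The formula of `chooseSum_mem` does not involve r on its right side. For r = d-1 the point is
-(d-1)/d = -1 - (-1/d), the mirror image of -1/d. -/
theorem chooseSum_neg_inv_mem (h3 : 3 < p) {d : ℕ} (hd : ¬ p ∣ d) (hd1 : 1 < d)
    (hmod : p % d = 1 ∨ p % d = d - 1) :
    chooseSum (-1 / d : ℚ) (p - 1) - (2 * d * classSum p d 1 (d - 1)
      + 2 * d * (d - 1) * p ^ 2 * classSum p d 3 (d - 1)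
      + 2 / (3 * d) * p ^ 2 * bernoulli (p - 3)) ∈ pPow p 3 := by
  have hd0 : (d : ℚ) ≠ 0 := Nat.cast_ne_zero.2 (by omega)
  have h := (Nat.div_add_mod p d).symm
  rcases hmod with hm | hm
  · rw [hm] at h
    have h1 := chooseSum_mem h3 hd h one_pos hd1.le
    rwa [Nat.cast_one, ← neg_div] at h1
  · rw [hm] at h
    have h1 := chooseSum_mem h3 hd h (by omega) (by omega)
    rw [← chooseSum_symm, Nat.cast_sub hd1.le, Nat.cast_one] at h1
    rwa [show (-1 - -(((d : ℚ) - 1) / d)) = -1 / d by field_simp; ring] at h1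

theorem truncLog_pow_div (a : ℚ) : truncLog (a ^ (p - 1)) / p = fermatQuotient p a
    - 1 / 2 * p * fermatQuotient p a ^ 2 + 1 / 3 * p ^ 2 * fermatQuotient p a ^ 3 := by
  have hp0 : (p : ℚ) ≠ 0 := Nat.cast_ne_zero.2 hp.out.ne_zero
  rw [truncLog, fermatQuotient]
  field_simp

end

theorem theorem5p2 (p : ℕ) (hp : p.Prime) (h3 : 3 < p) :
    -- part (i)
    RatModEq p 3
      (∑ k ∈ Finset.Icc 1 (p - 1),
        ((2 * k).choose k * (3 * k).choose k : ℚ) / (27 ^ k * k))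
      (3 * fermatQuotient p 3 - 3 / 2 * p * fermatQuotient p 3 ^ 2
        + p ^ 2 * fermatQuotient p 3 ^ 3 + 52 / 27 * p ^ 2 * bernoulli (p - 3)) ∧
    -- part (ii)
    RatModEq p 3
      (∑ k ∈ Finset.Icc 1 (p - 1),
        ((2 * k).choose k * (4 * k).choose (2 * k) : ℚ) / (64 ^ k * k))
      (6 * fermatQuotient p 2 - 3 * p * fermatQuotient p 2 ^ 2
        + 2 * p ^ 2 * fermatQuotient p 2 ^ 3 + 7 / 2 * p ^ 2 * bernoulli (p - 3)) ∧
    -- part (iii)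
    RatModEq p 3
      (∑ k ∈ Finset.Icc 1 (p - 1),
        ((6 * k).choose (3 * k) * (3 * k).choose k : ℚ) / (432 ^ k * k))
      (4 * fermatQuotient p 2 + 3 * fermatQuotient p 3
        - p * (2 * fermatQuotient p 2 ^ 2 + 3 / 2 * fermatQuotient p 3 ^ 2)
        + p ^ 2 * (4 / 3 * fermatQuotient p 2 ^ 3 + fermatQuotient p 3 ^ 3)
        + 455 / 54 * p ^ 2 * bernoulli (p - 3)) ∧
    -- the right-hand side of (ii) and that of Sun's conjecture agree modulo `p ^ 3`,
    -- so that (ii) and Sun's conjecture are equivalent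
    RatModEq p 3
      (6 * fermatQuotient p 2 - 3 * p * fermatQuotient p 2 ^ 2
        + 2 * p ^ 2 * fermatQuotient p 2 ^ 3 + 7 / 2 * p ^ 2 * bernoulli (p - 3))
      (-3 * harmonic ((p - 1) / 2) + 7 / 4 * p ^ 2 * bernoulli (p - 3)) ∧
    -- Sun's conjecture
    RatModEq p 3
      (∑ k ∈ Finset.Icc 1 (p - 1),
        ((2 * k).choose k * (4 * k).choose (2 * k) : ℚ) / (64 ^ k * k))
      (-3 * harmonic ((p - 1) / 2) + 7 / 4 * p ^ 2 * bernoulli (p - 3)) := by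
  have : Fact p.Prime := ⟨hp⟩
  have h6 := mod_six h3
  have hii : RatModEq p 3
      (∑ k ∈ Finset.Icc 1 (p - 1),
        ((2 * k).choose k * (4 * k).choose (2 * k) : ℚ) / (64 ^ k * k))
      (6 * fermatQuotient p 2 - 3 * p * fermatQuotient p 2 ^ 2
        + 2 * p ^ 2 * fermatQuotient p 2 ^ 3 + 7 / 2 * p ^ 2 * bernoulli (p - 3)) := by
    rw [ratModEq_iff, sum_Icc_eq_chooseSum chooseProd_fourth]
    have h := chooseSum_neg_inv_mem h3 (not_dvd_four h3) (by norm_num) (by omega)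
    convert add_mem h (four_classSum_mem h3) using 1
    rw [truncLog_pow_div]
    push_cast
    ring
  have hiv : RatModEq p 3
      (6 * fermatQuotient p 2 - 3 * p * fermatQuotient p 2 ^ 2
        + 2 * p ^ 2 * fermatQuotient p 2 ^ 3 + 7 / 2 * p ^ 2 * bernoulli (p - 3))
      (-3 * harmonic ((p - 1) / 2) + 7 / 4 * p ^ 2 * bernoulli (p - 3)) := by
    rw [ratModEq_iff, ← classSum_two_one_zero (by omega)]
    convert two_classSum_mem h3 using 1
    rw [truncLog_pow_div]
    ring
  refine ⟨?_, hii, ?_, hiv, ?_⟩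
  · rw [ratModEq_iff, sum_Icc_eq_chooseSum chooseProd_third]
    have h := chooseSum_neg_inv_mem h3 (not_dvd_three h3) (by norm_num) (by omega)
    convert add_mem h (three_classSum_mem h3) using 1
    rw [truncLog_pow_div]
    push_cast
    ring
  · rw [ratModEq_iff, sum_Icc_eq_chooseSum chooseProd_sixth]
    have h := chooseSum_neg_inv_mem h3 (not_dvd_six h3) (by norm_num) (by omega)
    convert add_mem h (six_classSum_mem h3) using 1
    rw [truncLog_pow_div, truncLog_pow_div]
    push_cast
    ring
  · rw [ratModEq_iff] at hii hiv ⊢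
    convert add_mem hii hiv using 1
    ring
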